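/- Let $n\ge 1$. For $c=(c_1,\dots,c_n)\in\mathbb{R}^n$ and $d=(d_1,\dots,d_{n-1})\in\mathbb{R}^{n-1}$ let $A(c,d)$ be the real symmetric $n\times n$ arrow matrix with diagonal $(d_1,\dots,d_{n-1},c_n)$, with last row and last column $(c_1,\dots,c_n)$, and with all other entries equal to $0$. Write $A(c,d)=Q\,\mathrm{diag}(\lambda_1,\dots,\lambda_n)\,Q^t$ with $Q$ orthogonal, $\lambda_1\ge\dots\ge\lambda_n$, and $Q$ chosen so that its last row $q=(q_1,\dots,q_n)$ has nonnegative entries. Let $f:(c,d)\mapsto(q,\lambda)$; let $dq$ be the surface-area element on the unit sphere of $\mathbb{R}^n$, and let $d\lambda$, $dc$, $dd$ be Lebesgue measure. (i) If $c_i\neq 0$ for $1\le i\le n-1$ and the $d_i$ are pairwise distinct, then $(q,\lambda)$ is uniquely determined by $(c,d)$. (ii) At every such point $f$ is differentiable, and its Jacobian as a map into (unit sphere)$\,\times\,\mathbb{R}^n$, i.e. the ratio $\sqrt{\det(J^tJ)}$ of the volume element $dq\,d\lambda$ to $dc\,dd$, where $J$ is the matrix of partial derivatives of $(q,\lambda)$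 with respect to $(c,d)$, equals $$\frac{\prod_{i=1}^{n}q_i}{\prod_{i=1}^{n-1}|c_i|}.$$ (iii) On the set of $(c,d)$ with $c_i>0$ for $1\le i\le n-1$ and $d_1>\dots>d_{n-1}$ we have $$dq\,d\lambda=\frac{\prod_{i=1}^{n}q_i}{\prod_{i=1}^{n-1}c_i}\,dc\,dd,$$ that is, for every Borel subset $E$ of this set, the $dq\,d\lambda$-measure of $f(E)$ equals $\int_E \frac{\prod_{i=1}^{n}q_i}{\prod_{i=1}^{n-1}c_i}\,dc\,dd$. -/

import Mathlib

open MeasureTheory Matrix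

/-- The real symmetric arrow matrix of size `m + 1` with border `c = (c_1, …, c_{m+1})`
(last row and last column, corner entry `c_{m+1}` included) and with `d = (d_1, …, d_m)` on
the rest of the diagonal; all other entries vanish. -/
def arrowMatrix {m : ℕ} (c : Fin (m + 1) → ℝ) (d : Fin m → ℝ) :
    Matrix (Fin (m + 1)) (Fin (m + 1)) ℝ :=
  Matrix.of fun i j =>
    if i = j then (Fin.snoc (α := fun _ => ℝ) d (c (Fin.last m)) : Fin (m + 1) → ℝ) i
    else if j = Fin.last m then c i
    else if i = Fin.last m then c j
    else 0

/-- `p = (q, lam)` is spectral data of the arrow matrix `A` of `(c, d)`: there is an orthogonal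
matrix `Q` of eigenvectors (columns) with `A = Q diag(lam) Qᵀ`, the eigenvalues `lam` are listed
in decreasing order, and `q` is the last row of `Q` and has nonnegative entries. -/
def IsArrowSpectralData {m : ℕ} (c : Fin (m + 1) → ℝ) (d : Fin m → ℝ)
    (p : EuclideanSpace ℝ (Fin (m + 1)) × (Fin (m + 1) → ℝ)) : Prop :=
  ∃ Q : Matrix (Fin (m + 1)) (Fin (m + 1)) ℝ,
    Q ∈ Matrix.orthogonalGroup (Fin (m + 1)) ℝ ∧
    arrowMatrix c d = Q * Matrix.diagonal p.2 * Qᵀ ∧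
    (∀ i, p.1 i = Q (Fin.last m) i) ∧ (∀ i, 0 ≤ p.1 i) ∧ Antitone p.2

theorem arrowMatrix_isHermitian {m : ℕ} (c : Fin (m + 1) → ℝ) (d : Fin m → ℝ) :
    (arrowMatrix c d).IsHermitian := by
  ext i j
  simp only [arrowMatrix, Matrix.conjTranspose_apply, Matrix.of_apply, star_trivial]
  by_cases h : i = j
  · subst h; rfl
  · have h' : ¬ j = i := fun e => h e.symm
    simp only [h, h', if_false]
    by_cases hi : i = Fin.last m <;> by_cases hj : j = Fin.last m <;> simp_all

/-- Every arrow matrix has spectral data. -/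
theorem exists_isArrowSpectralData {m : ℕ} (c : Fin (m + 1) → ℝ) (d : Fin m → ℝ) :
    ∃ p, IsArrowSpectralData c d p := by
  have hA := arrowMatrix_isHermitian c d
  set U : Matrix (Fin (m + 1)) (Fin (m + 1)) ℝ := 
    (hA.eigenvectorUnitary : Matrix (Fin (m + 1)) (Fin (m + 1)) ℝ) with hU
  have hU1 : star U * U = 1 := Unitary.coe_star_mul_self hA.eigenvectorUnitary
  have hsp : arrowMatrix c d = U * Matrix.diagonal hA.eigenvalues * star U := by
    have := hA.spectral_theorem
    simpa [Unitary.conjStarAlgAut_apply, Function.comp_def] using this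
  set s : Equiv.Perm (Fin (m + 1)) := Tuple.sort (fun i => - hA.eigenvalues i) with hs
  have hmono := Tuple.monotone_sort (fun i => - hA.eigenvalues i)
  set e : Fin (m + 1) → ℝ := fun k => if U (Fin.last m) (s k) < 0 then -1 else 1 with he
  have hee : ∀ k, e k * e k = 1 := by
    intro k; simp only [he]; split_ifs <;> norm_num
  let Q : Matrix (Fin (m + 1)) (Fin (m + 1)) ℝ := Matrix.of fun i k => e k * U i (s k)
  have hQ : ∀ i k, Q i k = e k * U i (s k) := fun _ _ => rfl
  refine ⟨(WithLp.toLp 2 (fun k => Q (Fin.last m) k), fun k => hA.eigenvalues (s k)),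
    Q, ?_, ?_, fun i => rfl, ?_, ?_⟩
  · rw [Matrix.mem_orthogonalGroup_iff']
    ext a b
    have h := congrFun (congrFun hU1 (s a)) (s b)
    simp only [Matrix.mul_apply, Matrix.star_apply, star_trivial, Matrix.one_apply,
      s.injective.eq_iff] at h ⊢
    have h2 : ∑ x, Q x a * Q x b = e a * e b * ∑ x, U x (s a) * U x (s b) := by
      rw [Finset.mul_sum]
      refine Finset.sum_congr rfl fun x _ => ?_
      simp only [hQ]; ring
    change ∑ x, Q x a * Q x b = _
    rw [h2, h]
    split_ifs with hab
    · subst hab; simp [hee]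
    · simp
  · refine hsp.trans ?_
    ext a b
    rw [Matrix.mul_apply, Matrix.mul_apply]
    simp only [Matrix.mul_diagonal, Matrix.star_apply, star_trivial, Matrix.transpose_apply]
    rw [← Equiv.sum_comp s]
    refine Finset.sum_congr rfl fun x _ => ?_
    simp only [hQ]
    linear_combination (-(U a (s x) * hA.eigenvalues (s x) * U b (s x))) * hee x
  · intro i
    change 0 ≤ Q (Fin.last m) i
    simp only [hQ, he]
    split_ifs with h <;> linarith
  · intro a b hab
    have := hmono hab
    simp only [Function.comp] at this
    linarith

/-- The map `f : (c, d) ↦ (q, lam)` which sends an arrow matrix to the last row of its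
eigenvector matrix and its eigenvalues. -/
noncomputable def arrowMap {m : ℕ} (x : (Fin (m + 1) → ℝ) × (Fin m → ℝ)) :
    EuclideanSpace ℝ (Fin (m + 1)) × (Fin (m + 1) → ℝ) :=
  (exists_isArrowSpectralData x.1 x.2).choose

/-- The matrix of all first partial derivatives of a map `(c, d) ↦ (q, lam)` at the point `x`,
with respect to the standard coordinates. -/
noncomputable def partialsMatrix {m : ℕ}
    (f : (Fin (m + 1) → ℝ) × (Fin m → ℝ) →
      EuclideanSpace ℝ (Fin (m + 1)) × (Fin (m + 1) → ℝ))
    (x : (Fin (m + 1) → ℝ) × (Fin m → ℝ)) :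
    Matrix (Fin (m + 1) ⊕ Fin (m + 1)) (Fin (m + 1) ⊕ Fin m) ℝ :=
  LinearMap.toMatrix
    ((Pi.basisFun ℝ (Fin (m + 1))).prod (Pi.basisFun ℝ (Fin m)))
    ((EuclideanSpace.basisFun (Fin (m + 1)) ℝ).toBasis.prod (Pi.basisFun ℝ (Fin (m + 1))))
    (fderiv ℝ f x : (Fin (m + 1) → ℝ) × (Fin m → ℝ) →ₗ[ℝ]
      EuclideanSpace ℝ (Fin (m + 1)) × (Fin (m + 1) → ℝ))

/-- The (absolute value of the) Jacobian `√det(JᵀJ)` of a map `(c, d) ↦ (q, lam)` from the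
`(2m+1)`-dimensional parameter space into the `(2m+1)`-dimensional submanifold
`sphere × ℝ^(m+1)` of `ℝ^(m+1) × ℝ^(m+1)`. It is the ratio of the volume element `dq dlam`
of this submanifold, with `dq` the surface element of the sphere, to `dc dd`. -/
noncomputable def surfaceJacobian {m : ℕ}
    (f : (Fin (m + 1) → ℝ) × (Fin m → ℝ) →
      EuclideanSpace ℝ (Fin (m + 1)) × (Fin (m + 1) → ℝ))
    (x : (Fin (m + 1) → ℝ) × (Fin m → ℝ)) : ℝ :=
  Real.sqrt ((partialsMatrix f x)ᵀ * partialsMatrix f x).det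

/-- The surface-area measure `dq` of the unit sphere of `ℝ^n`, as a measure on `ℝ^n`. -/
noncomputable def sphereArea (n : ℕ) : Measure (EuclideanSpace ℝ (Fin n)) :=
  (volume : Measure (EuclideanSpace ℝ (Fin n))).toSphere.map Subtype.val

/-!
Write `n = m + 1`, and let `x = (c, d)` with no `c_1, …, c_m` zero and the `d_i` distinct.
The last entry of an eigenvector
of the arrow matrix cannot vanish, no eigenvalue is a `d_i`, and so the matrix of eigenvectors has
the Cauchy-like form `Q_ik = c_i q_k / (lam_k - d_i)`, `Q_nk = q_k`. The last row of the eigenvector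
equation is the secular equation `lam - c_n - ∑ c_i² / (lam - d_i) = 0`, and normalization gives
`q_k⁻² = 1 + ∑ c_i² / (lam_k - d_i)²`, the derivative of the secular function at `lam_k`
(`IsArrowSpectralData.arrowSpectrum`; `isArrowSpectralData_of_secular` is the converse). Uniqueness
follows, and since that derivative is positive, the implicit function theorem gives
differentiability (`ArrowGeneric.differentiableAt`).

For the Jacobian consider the cone `((d, r), c) ↦ (r q, lam)` over the map, which goes between spaces
of equal dimension `2n`. Differentiating the secular equation gives `dlam`
(`ArrowGeneric.fderiv_snd`); differentiating the logarithm of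
`q_k² ∏_{j ≠ k} (lam_k - lam_j) = ∏ᵢ (lam_k - d_i)` gives
`dq_k = -(q_k / 2) ∑ᵢ dd_i / (lam_k - d_i)` modulo the `dlam_j` (`ArrowGeneric.exists_fderiv_fst`).
Modulo row operations the derivative of the cone is thus block triangular, with diagonal blocks
`Qᵀ diag(-r / (2 c_i), 1)` and `diag(q) Qᵀ diag(2, …, 2, 1)`. As `|det Q| = 1`, its determinant is
`r^m ∏ q_k / ∏ |c_i|` up to sign (`abs_det_fderiv_arrowCone`). At `r = 1` the radial column is a unit
vector orthogonal to the others, so this is the surface Jacobian (`surfaceJacobian_arrowMap`).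

For the identity of measures, the surface area on the sphere is `n` times the volume of the cone over
a set, the cone is injective (`injOn_arrowCone`), and the change of variables formula together with
`n ∫₀¹ r^m dr = 1` gives the result (`sphereArea_prod_image_arrowMap`).
-/

/-! ### The secular equation and the eigenvectors -/

/-- The parameters at which the arrow matrix is non-degenerate: no `c_1, …, c_m` vanishes and the
`d_i` are pairwise distinct. Then no eigenvalue equals any `d_i`. -/
def ArrowGeneric {m : ℕ} (x : (Fin (m + 1) → ℝ) × (Fin m → ℝ)) : Prop :=
  (∀ i : Fin m, x.1 i.castSucc ≠ 0) ∧ Function.Injective x.2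

/-- The secular function `t - c_{m+1} - ∑ c_i² / (t - d_i)`, whose zeros are the eigenvalues of a
non-degenerate arrow matrix. -/
noncomputable def arrowSecular {m : ℕ} (x : (Fin (m + 1) → ℝ) × (Fin m → ℝ)) (t : ℝ) : ℝ :=
  t - x.1 (Fin.last m) - ∑ i : Fin m, x.1 i.castSucc ^ 2 / (t - x.2 i)

/-- The derivative `1 + ∑ c_i² / (t - d_i)²` of the secular function in `t`. At an eigenvalue it is
the square of the norm of the eigenvector with last entry `1`. -/
noncomputable def arrowSecularDeriv {m : ℕ} (x : (Fin (m + 1) → ℝ) × (Fin m → ℝ)) (t : ℝ) : ℝ :=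
  1 + ∑ i : Fin m, x.1 i.castSucc ^ 2 / (t - x.2 i) ^ 2

/-- The matrix whose `k`-th column is the multiple with last entry `q_k` of the vector
`(c_1 / (lam_k - d_1), …, c_m / (lam_k - d_m), 1)`. -/
noncomputable def arrowEigenvectors {m : ℕ} (x : (Fin (m + 1) → ℝ) × (Fin m → ℝ))
    (q lam : Fin (m + 1) → ℝ) : Matrix (Fin (m + 1)) (Fin (m + 1)) ℝ :=
  Matrix.of fun i k =>
    (Fin.snoc (α := fun _ => ℝ) (fun i : Fin m => x.1 i.castSucc * q k / (lam k - x.2 i)) (q k) :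
      Fin (m + 1) → ℝ) i

section

variable {m : ℕ} {x : (Fin (m + 1) → ℝ) × (Fin m → ℝ)}

@[simp] theorem arrowEigenvectors_castSucc (q lam : Fin (m + 1) → ℝ) (i : Fin m)
    (k : Fin (m + 1)) :
    arrowEigenvectors x q lam i.castSucc k = x.1 i.castSucc * q k / (lam k - x.2 i) := by
  simp [arrowEigenvectors]

@[simp] theorem arrowEigenvectors_last (q lam : Fin (m + 1) → ℝ) (k : Fin (m + 1)) :
    arrowEigenvectors x q lam (Fin.last m) k = q k := by
  simp [arrowEigenvectors]

theorem arrowSecularDeriv_pos (x : (Fin (m + 1) → ℝ) × (Fin m → ℝ)) (t : ℝ) :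
    0 < arrowSecularDeriv x t := by
  have : 0 ≤ ∑ i : Fin m, x.1 i.castSucc ^ 2 / (t - x.2 i) ^ 2 :=
    Finset.sum_nonneg fun i _ => by positivity
  unfold arrowSecularDeriv
  linarith

theorem arrowMatrix_mul_castSucc (c : Fin (m + 1) → ℝ) (d : Fin m → ℝ)
    (M : Matrix (Fin (m + 1)) (Fin (m + 1)) ℝ) (i : Fin m) (k : Fin (m + 1)) :
    (arrowMatrix c d * M) i.castSucc k =
      d i * M i.castSucc k + c i.castSucc * M (Fin.last m) k := by
  rw [Matrix.mul_apply, Fin.sum_univ_castSucc]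
  congr 1
  · rw [Finset.sum_eq_single i]
    · simp [arrowMatrix]
    · intro j _ hj
      have : ¬ i = j := fun h => hj h.symm
      simp [arrowMatrix, this, Fin.castSucc_ne_last]
    · simp
  · simp [arrowMatrix, Fin.castSucc_ne_last]

theorem arrowMatrix_mul_last (c : Fin (m + 1) → ℝ) (d : Fin m → ℝ)
    (M : Matrix (Fin (m + 1)) (Fin (m + 1)) ℝ) (k : Fin (m + 1)) :
    (arrowMatrix c d * M) (Fin.last m) k =
      ∑ i : Fin m, c i.castSucc * M i.castSucc k + c (Fin.last m) * M (Fin.last m) k := by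
  rw [Matrix.mul_apply, Fin.sum_univ_castSucc]
  congr 1
  · refine Finset.sum_congr rfl fun i _ => ?_
    have : ¬ Fin.last m = i.castSucc := (Fin.castSucc_ne_last i).symm
    simp [arrowMatrix, this, Fin.castSucc_ne_last]
  · simp [arrowMatrix]

/-- The explicit description of spectral data of a non-degenerate arrow matrix: `q` is positive,
the eigenvalues are distinct zeros of the secular function, and `Q` is given by the Cauchy-like
formula of `arrowEigenvectors`. -/
structure ArrowSpectrum (x : (Fin (m + 1) → ℝ) × (Fin m → ℝ)) (q lam : Fin (m + 1) → ℝ) :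
    Prop where
  pos : ∀ k, 0 < q k
  ne : ∀ k i, lam k - x.2 i ≠ 0
  strictAnti : StrictAnti lam
  secular : ∀ k, arrowSecular x (lam k) = 0
  sq_mul : ∀ k, q k ^ 2 * arrowSecularDeriv x (lam k) = 1
  orthogonal : arrowEigenvectors x q lam ∈ Matrix.orthogonalGroup (Fin (m + 1)) ℝ

theorem transpose_mul_arrowEigenvectors (q lam : Fin (m + 1) → ℝ) (j k : Fin (m + 1)) :
    ((arrowEigenvectors x q lam)ᵀ * arrowEigenvectors x q lam) j k =
      q j * q k * (1 + ∑ i : Fin m,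
        x.1 i.castSucc ^ 2 / ((lam j - x.2 i) * (lam k - x.2 i))) := by
  rw [Matrix.mul_apply, Fin.sum_univ_castSucc]
  simp only [Matrix.transpose_apply, arrowEigenvectors_castSucc, arrowEigenvectors_last]
  rw [mul_add, mul_one, add_comm, Finset.mul_sum]
  congr 1
  refine Finset.sum_congr rfl fun i _ => ?_
  rw [div_mul_div_comm, mul_div_assoc']
  congr 1
  ring

/-- In the non-degenerate case the eigenvector equation forces the last entry of an eigenvector to be
nonzero and determines the other entries from it. -/
theorem IsArrowSpectralData.arrowSpectrum (hx : ArrowGeneric x)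
    {p : EuclideanSpace ℝ (Fin (m + 1)) × (Fin (m + 1) → ℝ)}
    (h : IsArrowSpectralData x.1 x.2 p) : ArrowSpectrum x (p.1 : Fin (m + 1) → ℝ) p.2 := by
  obtain ⟨Q, hQ, hA, hq, hq0, hanti⟩ := h
  have hQQ : Qᵀ * Q = 1 := (Matrix.mem_orthogonalGroup_iff' _ _).1 hQ
  have hAQ : arrowMatrix x.1 x.2 * Q = Q * Matrix.diagonal p.2 := by
    rw [hA, Matrix.mul_assoc, hQQ, Matrix.mul_one]
  have h1 : ∀ (i : Fin m) k, x.2 i * Q i.castSucc k + x.1 i.castSucc * p.1 k = Q i.castSucc k * p.2 k := by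
    intro i k
    rw [hq, ← arrowMatrix_mul_castSucc, hAQ, Matrix.mul_diagonal]
  have h2 : ∀ k, ∑ i : Fin m, x.1 i.castSucc * Q i.castSucc k + x.1 (Fin.last m) * p.1 k
      = p.1 k * p.2 k := by
    intro k
    rw [hq, ← arrowMatrix_mul_last, hAQ, Matrix.mul_diagonal]
  have horth : ∀ j k, ∑ i : Fin m, Q i.castSucc j * Q i.castSucc k + p.1 j * p.1 k =
      if j = k then 1 else 0 := by
    intro j k
    have := congrFun (congrFun hQQ j) k
    rw [Matrix.mul_apply, Fin.sum_univ_castSucc, Matrix.one_apply] at this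
    simpa [hq] using this
  have hpos : ∀ k, 0 < p.1 k := by
    intro k
    refine lt_of_le_of_ne (hq0 k) fun h0 => ?_
    -- the rest of the column would be supported at one index, where `c` does not vanish
    have h3 : ∀ i : Fin m, Q i.castSucc k ≠ 0 → x.2 i = p.2 k := by
      intro i hi
      have := h1 i k
      rw [← h0] at this
      exact mul_right_cancel₀ hi (by linarith)
    have h4 : ∀ i : Fin m, Q i.castSucc k = 0 := by
      intro i
      by_contra hi
      have := h2 k
      rw [Finset.sum_eq_single i, ← h0] at this
      · exact mul_ne_zero (hx.1 i) hi (by linarith)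
      · intro j _ hj
        by_contra hne
        exact hj (hx.2 ((h3 j (right_ne_zero_of_mul hne)).trans (h3 i hi).symm))
      · simp
    have := horth k k
    simp [h4, ← h0] at this
  have hne : ∀ k i, p.2 k - x.2 i ≠ 0 := by
    intro k i h0
    have := h1 i k
    have h5 : x.1 i.castSucc * p.1 k = 0 := by linear_combination this + Q i.castSucc k * h0
    exact mul_ne_zero (hx.1 i) (hpos k).ne' h5
  have hQe : Q = arrowEigenvectors x p.1 p.2 := by
    ext i k
    induction i using Fin.lastCases with
    | last => simp [hq]
    | cast i =>
      rw [arrowEigenvectors_castSucc, eq_div_iff (hne k i)]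
      linear_combination -h1 i k
  have hQo : arrowEigenvectors x p.1 p.2 ∈ Matrix.orthogonalGroup (Fin (m + 1)) ℝ := hQe ▸ hQ
  have hgram := fun j k => congrFun (congrFun ((Matrix.mem_orthogonalGroup_iff' _ _).1 hQo) j) k
  simp only [transpose_mul_arrowEigenvectors, Matrix.one_apply] at hgram
  refine ⟨hpos, hne, ?_, ?_, ?_, hQo⟩
  · refine hanti.strictAnti_of_injective fun j k hjk => ?_
    by_contra hne'
    have e1 := hgram j k
    have e2 := hgram k k
    rw [if_neg hne', hjk] at e1
    rw [if_pos rfl] at e2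
    rcases mul_eq_zero.1 e1 with e | e
    · exact mul_ne_zero (hpos j).ne' (hpos k).ne' e
    · rw [e] at e2; simp at e2
  · intro k
    have := h2 k
    have e : ∑ i : Fin m, x.1 i.castSucc * Q i.castSucc k =
        p.1 k * ∑ i : Fin m, x.1 i.castSucc ^ 2 / (p.2 k - x.2 i) := by
      rw [Finset.mul_sum]
      refine Finset.sum_congr rfl fun i _ => ?_
      rw [hQe, arrowEigenvectors_castSucc]
      ring
    rw [e] at this
    refine mul_left_cancel₀ (hpos k).ne' ?_
    unfold arrowSecular
    linear_combination -this
  · intro k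
    have := hgram k k
    rw [if_pos rfl] at this
    rw [← this, arrowSecularDeriv]
    simp only [sq]

/-- Distinct zeros of the secular function give orthonormal eigenvectors. -/
theorem isArrowSpectralData_of_secular {lam : Fin (m + 1) → ℝ}
    (hne : ∀ k i, lam k - x.2 i ≠ 0) (hanti : StrictAnti lam)
    (hsec : ∀ k, arrowSecular x (lam k) = 0) :
    IsArrowSpectralData x.1 x.2
      (WithLp.toLp 2 fun k => (Real.sqrt (arrowSecularDeriv x (lam k)))⁻¹, lam) := by
  set q : Fin (m + 1) → ℝ := fun k => (Real.sqrt (arrowSecularDeriv x (lam k)))⁻¹ with hq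
  have hq2 : ∀ k, q k * q k * arrowSecularDeriv x (lam k) = 1 := by
    intro k
    have h0 := arrowSecularDeriv_pos x (lam k)
    simp only [hq]
    rw [← mul_inv, Real.mul_self_sqrt h0.le, inv_mul_cancel₀ h0.ne']
  have hQQ : (arrowEigenvectors x q lam)ᵀ * arrowEigenvectors x q lam = 1 := by
    ext j k
    rw [transpose_mul_arrowEigenvectors, Matrix.one_apply]
    split_ifs with hjk
    · subst hjk
      have := hq2 j
      simp only [arrowSecularDeriv, sq] at this
      simpa only [sq] using this
    · -- subtract the secular equations of `lam j` and `lam k`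
      have hsub : lam j - lam k ≠ 0 := sub_ne_zero.2 fun e => hjk (hanti.injective e)
      have e : (lam j - lam k) * (1 + ∑ i : Fin m,
          x.1 i.castSucc ^ 2 / ((lam j - x.2 i) * (lam k - x.2 i))) =
          arrowSecular x (lam j) - arrowSecular x (lam k) := by
        have : ∑ i : Fin m, x.1 i.castSucc ^ 2 / (lam j - x.2 i) -
            ∑ i : Fin m, x.1 i.castSucc ^ 2 / (lam k - x.2 i) =
            -((lam j - lam k) * ∑ i : Fin m,
              x.1 i.castSucc ^ 2 / ((lam j - x.2 i) * (lam k - x.2 i))) := by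
          rw [← Finset.sum_sub_distrib, Finset.mul_sum, ← Finset.sum_neg_distrib]
          refine Finset.sum_congr rfl fun i _ => ?_
          have := hne j i
          have := hne k i
          field_simp
          ring
        unfold arrowSecular
        linear_combination this
      rw [hsec, hsec, sub_zero] at e
      rw [(mul_eq_zero.1 e).resolve_left hsub, mul_zero]
  refine ⟨arrowEigenvectors x q lam, (Matrix.mem_orthogonalGroup_iff' _ _).2 hQQ, ?_,
    fun k => by simp, fun k => inv_nonneg.2 (Real.sqrt_nonneg _), hanti.antitone⟩
  have hAQ : arrowMatrix x.1 x.2 * arrowEigenvectors x q lam =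
      arrowEigenvectors x q lam * Matrix.diagonal lam := by
    ext i k
    rw [Matrix.mul_diagonal]
    induction i using Fin.lastCases with
    | last =>
      rw [arrowMatrix_mul_last]
      simp only [arrowEigenvectors_castSucc, arrowEigenvectors_last]
      have e : ∑ i : Fin m, x.1 i.castSucc * (x.1 i.castSucc * q k / (lam k - x.2 i)) =
          q k * ∑ i : Fin m, x.1 i.castSucc ^ 2 / (lam k - x.2 i) := by
        rw [Finset.mul_sum]
        exact Finset.sum_congr rfl fun i _ => by ring
      have := hsec k
      unfold arrowSecular at this
      rw [e]
      linear_combination -(q k) * this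
    | cast i =>
      rw [arrowMatrix_mul_castSucc]
      simp only [arrowEigenvectors_castSucc, arrowEigenvectors_last]
      have := hne k i
      field_simp
      ring
  rw [← hAQ, Matrix.mul_assoc, mul_eq_one_comm.1 hQQ, Matrix.mul_one]

theorem IsArrowSpectralData.range_subset {c : Fin (m + 1) → ℝ} {d : Fin m → ℝ}
    {p p' : EuclideanSpace ℝ (Fin (m + 1)) × (Fin (m + 1) → ℝ)}
    (h : IsArrowSpectralData c d p) (h' : IsArrowSpectralData c d p') :
    Set.range p.2 ⊆ Set.range p'.2 := by
  obtain ⟨Q, hQ, hA, -⟩ := h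
  obtain ⟨R, hR, hB, -⟩ := h'
  have hQQ : Qᵀ * Q = 1 := (Matrix.mem_orthogonalGroup_iff' _ _).1 hQ
  have hRR : Rᵀ * R = 1 := (Matrix.mem_orthogonalGroup_iff' _ _).1 hR
  -- `Rᵀ Q` intertwines the two diagonal matrices, and none of its columns vanishes
  have hW : Matrix.diagonal p'.2 * (Rᵀ * Q) = (Rᵀ * Q) * Matrix.diagonal p.2 := by
    have e1 : Rᵀ * (arrowMatrix c d * Q) = Rᵀ * Q * Matrix.diagonal p.2 := by
      rw [hA, Matrix.mul_assoc (Q * _), hQQ, Matrix.mul_one, Matrix.mul_assoc]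
    rw [← e1, hB]
    simp only [← Matrix.mul_assoc]
    rw [hRR, Matrix.one_mul]
  have hWW : (Rᵀ * Q)ᵀ * (Rᵀ * Q) = 1 := by
    rw [Matrix.transpose_mul, Matrix.transpose_transpose, Matrix.mul_assoc, ← Matrix.mul_assoc R,
      mul_eq_one_comm.1 hRR, Matrix.one_mul, hQQ]
  rintro _ ⟨k, rfl⟩
  have hk := congrFun (congrFun hWW k) k
  rw [Matrix.mul_apply, Matrix.one_apply_eq] at hk
  obtain ⟨j, -, hj⟩ := Finset.exists_ne_zero_of_sum_ne_zero (hk ▸ one_ne_zero)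
  have e := congrFun (congrFun hW j) k
  rw [Matrix.diagonal_mul, Matrix.mul_diagonal] at e
  exact ⟨j, mul_right_cancel₀ (right_ne_zero_of_mul hj) (by linarith)⟩

theorem IsArrowSpectralData.unique (hx : ArrowGeneric x)
    {p p' : EuclideanSpace ℝ (Fin (m + 1)) × (Fin (m + 1) → ℝ)}
    (h : IsArrowSpectralData x.1 x.2 p) (h' : IsArrowSpectralData x.1 x.2 p') : p = p' := by
  have s := h.arrowSpectrum hx
  have s' := h'.arrowSpectrum hx
  have hlam : p.2 = p'.2 := Set.range_injOn_strictAnti s.strictAnti s'.strictAnti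
    ((h.range_subset h').antisymm (h'.range_subset h))
  refine Prod.ext ?_ hlam
  ext k
  have e := s.sq_mul k
  have e' := s'.sq_mul k
  rw [← hlam, ← e] at e'
  have := mul_right_cancel₀ (arrowSecularDeriv_pos x (p.2 k)).ne' e'
  exact ((sq_eq_sq₀ (s'.pos k).le (s.pos k).le).1 this).symm

theorem isArrowSpectralData_arrowMap (x : (Fin (m + 1) → ℝ) × (Fin m → ℝ)) :
    IsArrowSpectralData x.1 x.2 (arrowMap x) :=
  (exists_isArrowSpectralData x.1 x.2).choose_spec

theorem ArrowGeneric.arrowSpectrum (hx : ArrowGeneric x) :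
    ArrowSpectrum x ((arrowMap x).1 : Fin (m + 1) → ℝ) (arrowMap x).2 :=
  (isArrowSpectralData_arrowMap x).arrowSpectrum hx

end

/-! ### Recovering the matrix from its spectral data -/

section

variable {m : ℕ} {x x' : (Fin (m + 1) → ℝ) × (Fin m → ℝ)} {q lam : Fin (m + 1) → ℝ}

theorem ArrowSpectrum.sum_sq (s : ArrowSpectrum x q lam) : ∑ k, q k ^ 2 = 1 := by
  have := congrFun (congrFun ((Matrix.mem_orthogonalGroup_iff _ _).1 s.orthogonal)
    (Fin.last m)) (Fin.last m)
  simpa [Matrix.mul_apply, sq] using this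

/-- Orthogonality of the last row of `Q` to the `i`-th one. -/
theorem ArrowSpectrum.sum_sq_div_sub (s : ArrowSpectrum x q lam) (hx : ArrowGeneric x)
    (i : Fin m) : ∑ k, q k ^ 2 / (lam k - x.2 i) = 0 := by
  have := congrFun (congrFun ((Matrix.mem_orthogonalGroup_iff _ _).1 s.orthogonal)
    i.castSucc) (Fin.last m)
  rw [Matrix.mul_apply, Matrix.one_apply_ne (Fin.castSucc_ne_last i)] at this
  have e : ∑ k, arrowEigenvectors x q lam i.castSucc k *
      (arrowEigenvectors x q lam)ᵀ k (Fin.last m) =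
      x.1 i.castSucc * ∑ k, q k ^ 2 / (lam k - x.2 i) := by
    rw [Finset.mul_sum]
    refine Finset.sum_congr rfl fun k _ => ?_
    simp only [Matrix.transpose_apply, arrowEigenvectors_castSucc, arrowEigenvectors_last]
    ring
  rw [e] at this
  exact (mul_eq_zero.1 this).resolve_left (hx.1 i)

/-- Normalization of the `i`-th row of `Q`. -/
theorem ArrowSpectrum.mul_sum_sq_div_sub_sq (s : ArrowSpectrum x q lam) (i : Fin m) :
    x.1 i.castSucc ^ 2 * ∑ k, q k ^ 2 / (lam k - x.2 i) ^ 2 = 1 := by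
  have := congrFun (congrFun ((Matrix.mem_orthogonalGroup_iff _ _).1 s.orthogonal)
    i.castSucc) i.castSucc
  rw [Matrix.mul_apply, Matrix.one_apply_eq] at this
  rw [← this, Finset.mul_sum]
  refine Finset.sum_congr rfl fun k _ => ?_
  simp only [Matrix.transpose_apply, arrowEigenvectors_castSucc]
  have := s.ne k i
  field_simp

open Polynomial in
/-- The characteristic polynomial of `diag(d)` in terms of the spectral data: both sides are monic
of degree `m`, and by the orthogonality of the rows of `Q` the right side vanishes at each `d_i`. -/
theorem ArrowSpectrum.nodal_eq (s : ArrowSpectrum x q lam) (hx : ArrowGeneric x) :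
    Lagrange.nodal Finset.univ x.2 =
      ∑ k, C (q k ^ 2) * Lagrange.nodal (Finset.univ.erase k) lam := by
  set N : ℝ[X] := ∑ k, C (q k ^ 2) * Lagrange.nodal (Finset.univ.erase k) lam with hN
  have hdeg : ∀ k, (Lagrange.nodal (Finset.univ.erase k) lam).natDegree = m := by
    intro k
    simp [Finset.card_erase_of_mem (Finset.mem_univ k)]
  have hcoeff : N.coeff m = 1 := by
    rw [hN, finsetSum_coeff, ← s.sum_sq]
    refine Finset.sum_congr rfl fun k _ => ?_
    have : (Lagrange.nodal (Finset.univ.erase k) lam).coeff m = 1 := by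
      have h := (Lagrange.nodal_monic (s := Finset.univ.erase k) (v := lam)).coeff_natDegree
      rwa [hdeg] at h
    rw [coeff_C_mul, this, mul_one]
  have hle : N.natDegree ≤ m := natDegree_sum_le_of_forall_le _ _ fun k _ =>
    (natDegree_C_mul_le _ _).trans (hdeg k).le
  have hmonic : N.Monic := monic_of_natDegree_le_of_coeff_eq_one m hle hcoeff
  have hNdeg : N.natDegree = m :=
    natDegree_eq_of_le_of_coeff_ne_zero hle (by rw [hcoeff]; exact one_ne_zero)
  refine Polynomial.eq_of_degree_le_of_eval_index_eq Finset.univ (v := x.2)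
    hx.2.injOn (by simp) ?_ ?_ fun i hi => ?_
  · rw [Lagrange.degree_nodal, degree_eq_natDegree hmonic.ne_zero, hNdeg]
    simp
  · rw [hmonic.leadingCoeff, Lagrange.nodal_monic.leadingCoeff]
  · rw [Lagrange.eval_nodal_at_node hi, hN, eval_finsetSum]
    simp only [eval_mul, eval_C, Lagrange.eval_nodal]
    have e : ∀ k, q k ^ 2 * ∏ j ∈ Finset.univ.erase k, (x.2 i - lam j) =
        -(∏ j, (x.2 i - lam j)) * (q k ^ 2 / (lam k - x.2 i)) := by
      intro k
      rw [← Finset.mul_prod_erase _ _ (Finset.mem_univ k)]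
      have := s.ne k i
      field_simp
      ring
    simp only [e]
    rw [← Finset.mul_sum, s.sum_sq_div_sub hx i, mul_zero]

theorem ArrowSpectrum.sq_mul_prod (s : ArrowSpectrum x q lam) (hx : ArrowGeneric x)
    (k : Fin (m + 1)) :
    q k ^ 2 * ∏ j ∈ Finset.univ.erase k, (lam k - lam j) = ∏ i, (lam k - x.2 i) := by
  rw [← Lagrange.eval_nodal (s := Finset.univ) (v := x.2), s.nodal_eq hx,
    Polynomial.eval_finsetSum, Finset.sum_eq_single k]
  · rw [Polynomial.eval_mul, Polynomial.eval_C, Lagrange.eval_nodal]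
  · intro j _ hj
    rw [Polynomial.eval_mul, Lagrange.eval_nodal_at_node, mul_zero]
    exact Finset.mem_erase.2 ⟨hj.symm, Finset.mem_univ k⟩
  · simp

/-- The open set of parameters with `c_1, …, c_m` positive and `d` in decreasing order. -/
def positiveArrows (m : ℕ) : Set ((Fin (m + 1) → ℝ) × (Fin m → ℝ)) :=
  {x | (∀ i : Fin m, 0 < x.1 i.castSucc) ∧ StrictAnti x.2}

theorem arrowGeneric_of_mem_positiveArrows (hx : x ∈ positiveArrows m) : ArrowGeneric x :=
  ⟨fun i => (hx.1 i).ne', hx.2.injective⟩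

/-- The spectral data determine `d` by `ArrowSpectrum.nodal_eq`, then each `c_i²` with `i ≤ m` by the
normalization of the rows of `Q`, and finally `c_{m+1}` by the secular equation. -/
theorem ArrowSpectrum.eq_of_mem_positiveArrows (s : ArrowSpectrum x q lam)
    (s' : ArrowSpectrum x' q lam) (hx : x ∈ positiveArrows m) (hx' : x' ∈ positiveArrows m) :
    x = x' := by
  have hnodal := (s.nodal_eq (arrowGeneric_of_mem_positiveArrows hx)).trans
    (s'.nodal_eq (arrowGeneric_of_mem_positiveArrows hx')).symm
  have hroots : ∀ y : Fin m → ℝ, Set.range y =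
      {t | (Lagrange.nodal Finset.univ y).eval t = 0} := by
    intro y
    ext t
    rw [Set.mem_ofPred_eq, Lagrange.eval_nodal, Finset.prod_eq_zero_iff]
    simp [sub_eq_zero, eq_comm]
  have hd : x.2 = x'.2 :=
    (hx.2.range_inj hx'.2).1 (by rw [hroots, hroots, hnodal])
  have hc : ∀ i : Fin m, x.1 i.castSucc = x'.1 i.castSucc := by
    intro i
    have e := s.mul_sum_sq_div_sub_sq i
    have e' := s'.mul_sum_sq_div_sub_sq i
    rw [← hd, ← e] at e'
    refine ((sq_eq_sq₀ (hx'.1 i).le (hx.1 i).le).1 (mul_right_cancel₀ ?_ e')).symm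
    intro h0
    rw [h0, mul_zero] at e
    exact zero_ne_one e
  refine Prod.ext (funext fun i => ?_) hd
  induction i using Fin.lastCases with
  | cast i => exact hc i
  | last =>
    have e := s.secular 0
    have e' := s'.secular 0
    simp only [arrowSecular, ← hd, ← hc] at e e'
    linarith

/-! ### Differentiability -/

theorem hasDerivAt_arrowSecular {t : ℝ} (ht : ∀ i, t - x.2 i ≠ 0) :
    HasDerivAt (arrowSecular x) (arrowSecularDeriv x t) t := by
  have h : ∀ i ∈ Finset.univ, HasDerivAt (fun t : ℝ => x.1 (Fin.castSucc i) ^ 2 / (t - x.2 i))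
      (-(x.1 (Fin.castSucc i) ^ 2 / (t - x.2 i) ^ 2)) t := by
    intro i _
    have := (hasDerivAt_const t (x.1 (Fin.castSucc i) ^ 2)).fun_div
      ((hasDerivAt_id' t).sub_const (x.2 i)) (ht i)
    refine this.congr_deriv ?_
    ring
  refine (((hasDerivAt_id' t).sub_const (x.1 (Fin.last m))).sub
    (HasDerivAt.fun_sum h)).congr_deriv ?_
  simp [arrowSecularDeriv]

theorem contDiffAt_arrowSecular {t : ℝ} (ht : ∀ i, t - x.2 i ≠ 0) :
    ContDiffAt ℝ 1 (fun z : ((Fin (m + 1) → ℝ) × (Fin m → ℝ)) × ℝ => arrowSecular z.1 z.2)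
      (x, t) := by
  unfold arrowSecular
  refine ContDiffAt.sub (by fun_prop) (ContDiffAt.sum fun i _ => ContDiffAt.div ?_ ?_ (ht i))
  · fun_prop
  · fun_prop

/-- Near a non-degenerate arrow matrix its eigenvalues can be followed differentiably, because the
secular function has positive derivative. -/
theorem exists_differentiableAt_arrowSecular_eq_zero {t : ℝ} (ht : ∀ i, t - x.2 i ≠ 0)
    (h0 : arrowSecular x t = 0) :
    ∃ φ : (Fin (m + 1) → ℝ) × (Fin m → ℝ) → ℝ, DifferentiableAt ℝ φ x ∧ φ x = t ∧
      ∀ᶠ y in nhds x, arrowSecular y (φ y) = 0 := by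
  have hf := (contDiffAt_arrowSecular ht).hasStrictFDerivAt one_ne_zero
  set f' := fderiv ℝ
    (fun z : ((Fin (m + 1) → ℝ) × (Fin m → ℝ)) × ℝ => arrowSecular z.1 z.2) (x, t)
  have hd : HasDerivAt (arrowSecular x) (f' (0, 1)) t := by
    have := hf.hasFDerivAt.comp_hasDerivAt t ((hasDerivAt_const t x).prodMk (hasDerivAt_id' t))
    exact this
  have he : f' (0, 1) = arrowSecularDeriv x t := hd.unique (hasDerivAt_arrowSecular ht)
  have hinv : (f' ∘L .inr ℝ ((Fin (m + 1) → ℝ) × (Fin m → ℝ)) ℝ).IsInvertible := by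
    refine ⟨ContinuousLinearEquiv.unitsEquivAut ℝ
      (Units.mk0 _ (arrowSecularDeriv_pos x t).ne'), ?_⟩
    ext
    simp [he]
  refine ⟨hf.implicitFunctionOfProdDomain hinv,
    (hf.hasStrictFDerivAt_implicitFunctionOfProdDomain hinv).hasFDerivAt.differentiableAt,
    (hf.eventually_apply_eq_iff_implicitFunctionOfProdDomain hinv).self_of_nhds.mp rfl, ?_⟩
  simpa [h0] using hf.eventually_apply_implicitFunctionOfProdDomain hinv

theorem isOpen_arrowGeneric (m : ℕ) :
    IsOpen {x : (Fin (m + 1) → ℝ) × (Fin m → ℝ) | ArrowGeneric x} := by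
  have : {x : (Fin (m + 1) → ℝ) × (Fin m → ℝ) | ArrowGeneric x} =
      (⋂ i : Fin m, {x | x.1 i.castSucc ≠ 0}) ∩
        ⋂ i : Fin m, ⋂ j : Fin m, {x | i = j ∨ x.2 i ≠ x.2 j} := by
    ext x
    simp only [ArrowGeneric, Set.mem_ofPred_eq, Set.mem_inter_iff, Set.mem_iInter]
    refine and_congr Iff.rfl ⟨fun h i j => ?_, fun h i j hij => ?_⟩
    · exact or_iff_not_imp_left.2 fun hij => h.ne hij
    · exact (h i j).resolve_right (not_not.2 hij)
  rw [this]
  refine (isOpen_iInter_of_finite fun i => isOpen_ne_fun (by fun_prop) (by fun_prop)).inter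
    (isOpen_iInter_of_finite fun i => isOpen_iInter_of_finite fun j => ?_)
  by_cases hij : i = j
  · simp [hij]
  · simpa [hij] using isOpen_ne_fun
      (f := fun x : (Fin (m + 1) → ℝ) × (Fin m → ℝ) => x.2 i) (g := fun x => x.2 j)
      (by fun_prop) (by fun_prop)

theorem ArrowGeneric.eventually (hx : ArrowGeneric x) : ∀ᶠ y in nhds x, ArrowGeneric y :=
  (isOpen_arrowGeneric m).mem_nhds hx

theorem ArrowGeneric.differentiableAt (hx : ArrowGeneric x) :
    DifferentiableAt ℝ arrowMap x := by
  have s := hx.arrowSpectrum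
  -- near `x` the map is given by the continued zeros `φ k` of the secular function
  choose φ hφ hφx hφ0 using fun k =>
    exists_differentiableAt_arrowSecular_eq_zero (s.ne k) (s.secular k)
  have hne : ∀ k (i : Fin m), ∀ᶠ y in nhds x, φ k y - y.2 i ≠ 0 := fun k i =>
    ContinuousAt.eventually_ne (((hφ k).continuousAt).sub (by fun_prop))
      (by rw [hφx]; exact s.ne k i)
  have hanti : ∀ᶠ y in nhds x, StrictAnti fun k => φ k y := by
    have : ∀ j k : Fin (m + 1), j < k → ∀ᶠ y in nhds x, φ k y < φ j y := fun j k hjk =>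
      (hφ k).continuousAt.eventually_lt (hφ j).continuousAt
        (by rw [hφx, hφx]; exact s.strictAnti hjk)
    simpa only [StrictAnti, Filter.eventually_all] using this
  have hev : ∀ᶠ y in nhds x, arrowMap y =
      (WithLp.toLp 2 fun k => (Real.sqrt (arrowSecularDeriv y (φ k y)))⁻¹, fun k => φ k y) := by
    filter_upwards [hx.eventually, hanti, Filter.eventually_all.2 hφ0,
      Filter.eventually_all.2 fun k => Filter.eventually_all.2 (hne k)] with y hy h1 h2 h3
    exact (isArrowSpectralData_arrowMap y).unique hy (isArrowSpectralData_of_secular h3 h1 h2)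
  refine DifferentiableAt.congr_of_eventuallyEq ?_ hev
  refine DifferentiableAt.prodMk ?_ (differentiableAt_pi.2 hφ)
  have hq : ∀ k, DifferentiableAt ℝ (fun y => (Real.sqrt (arrowSecularDeriv y (φ k y)))⁻¹) x := by
    intro k
    have h0 := arrowSecularDeriv_pos x (φ k x)
    refine DifferentiableAt.fun_inv (h := fun y => Real.sqrt (arrowSecularDeriv y (φ k y)))
      (DifferentiableAt.sqrt ?_ h0.ne') (Real.sqrt_pos.2 h0).ne'
    unfold arrowSecularDeriv
    refine DifferentiableAt.const_add _ (DifferentiableAt.fun_sum fun i _ => ?_)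
    have h1 : φ k x - x.2 i ≠ 0 := by rw [hφx]; exact s.ne k i
    have h2 := hφ k
    fun_prop (disch := exact pow_ne_zero 2 h1)
  exact (PiLp.continuousLinearEquiv 2 ℝ (fun _ : Fin (m + 1) => ℝ)).symm.differentiableAt.comp x
    (differentiableAt_pi.2 hq)

end

/-! ### The derivative of the spectral data -/

section

variable {m : ℕ} {x : (Fin (m + 1) → ℝ) × (Fin m → ℝ)}

/-- Differentiation of the spectral data along the line through `x` in direction `v`. -/
theorem ArrowGeneric.hasDerivAt_line (hx : ArrowGeneric x)
    (v : (Fin (m + 1) → ℝ) × (Fin m → ℝ)) (k : Fin (m + 1)) :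
    HasDerivAt (fun t : ℝ => (arrowMap (x + t • v)).1 k) ((fderiv ℝ arrowMap x v).1 k) 0 ∧
      HasDerivAt (fun t : ℝ => (arrowMap (x + t • v)).2 k) ((fderiv ℝ arrowMap x v).2 k) 0 := by
  have hline : HasDerivAt (fun t : ℝ => x + t • v) v 0 := by
    simpa using ((hasDerivAt_id' (0 : ℝ)).smul_const v).const_add x
  have h : HasDerivAt (fun t : ℝ => arrowMap (x + t • v)) (fderiv ℝ arrowMap x v) 0 := by
    have hf : HasFDerivAt arrowMap (fderiv ℝ arrowMap x) (x + (0 : ℝ) • v) := by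
      simpa using hx.differentiableAt.hasFDerivAt
    exact hf.comp_hasDerivAt (0 : ℝ) hline
  constructor
  · exact ((EuclideanSpace.proj k : EuclideanSpace ℝ (Fin (m + 1)) →L[ℝ] ℝ) ∘L
      ContinuousLinearMap.fst ℝ _ (Fin (m + 1) → ℝ)).hasFDerivAt.comp_hasDerivAt (0 : ℝ) h
  · exact (ContinuousLinearMap.proj (R := ℝ) (φ := fun _ : Fin (m + 1) => ℝ) k ∘L
      ContinuousLinearMap.snd ℝ (EuclideanSpace ℝ (Fin (m + 1))) _).hasFDerivAt.comp_hasDerivAt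
        (0 : ℝ) h

theorem ArrowGeneric.eventually_line (hx : ArrowGeneric x)
    (v : (Fin (m + 1) → ℝ) × (Fin m → ℝ)) : ∀ᶠ t : ℝ in nhds 0, ArrowGeneric (x + t • v) := by
  have : Filter.Tendsto (fun t : ℝ => x + t • v) (nhds 0) (nhds x) := by
    have h : Continuous fun t : ℝ => x + t • v := by fun_prop
    simpa using h.tendsto 0
  exact this.eventually hx.eventually

theorem hasDerivAt_line_fst (v : (Fin (m + 1) → ℝ) × (Fin m → ℝ)) (i : Fin (m + 1)) :
    HasDerivAt (fun t : ℝ => (x + t • v).1 i) (v.1 i) 0 := by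
  simpa using ((hasDerivAt_id' (0 : ℝ)).mul_const (v.1 i)).const_add (x.1 i)

theorem hasDerivAt_line_snd (v : (Fin (m + 1) → ℝ) × (Fin m → ℝ)) (i : Fin m) :
    HasDerivAt (fun t : ℝ => (x + t • v).2 i) (v.2 i) 0 := by
  simpa using ((hasDerivAt_id' (0 : ℝ)).mul_const (v.2 i)).const_add (x.2 i)

/-- The first-order perturbation `dlam_k = Q_kᵀ dA Q_k` of the eigenvalues, obtained by
differentiating the secular equation. -/
theorem ArrowGeneric.fderiv_snd (hx : ArrowGeneric x)
    (v : (Fin (m + 1) → ℝ) × (Fin m → ℝ)) (k : Fin (m + 1)) :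
    (fderiv ℝ arrowMap x v).2 k = (arrowMap x).1 k ^ 2 * (v.1 (Fin.last m) +
      ∑ i : Fin m, (2 * (x.1 i.castSucc / ((arrowMap x).2 k - x.2 i)) * v.1 i.castSucc +
        (x.1 i.castSucc / ((arrowMap x).2 k - x.2 i)) ^ 2 * v.2 i)) := by
  have s := hx.arrowSpectrum
  have hl := (hx.hasDerivAt_line v k).2
  set l' := (fderiv ℝ arrowMap x v).2 k
  set l := (arrowMap x).2 k with hldef
  have hd : HasDerivAt
      (fun t : ℝ => arrowSecular (x + t • v) ((arrowMap (x + t • v)).2 k))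
      (l' - v.1 (Fin.last m) - ∑ i : Fin m,
        (2 * (x.1 i.castSucc / (l - x.2 i)) * v.1 i.castSucc -
          (x.1 i.castSucc / (l - x.2 i)) ^ 2 * (l' - v.2 i))) 0 := by
    refine (hl.sub (hasDerivAt_line_fst v _)).sub (HasDerivAt.fun_sum fun i _ => ?_)
    have hne : l - x.2 i ≠ 0 := s.ne k i
    have := ((hasDerivAt_line_fst (x := x) v i.castSucc).pow 2).fun_div
      (hl.sub (hasDerivAt_line_snd (x := x) v i)) (by simpa [← hldef] using hne)
    refine this.congr_deriv ?_
    simp only [zero_smul, add_zero, ← hldef, Pi.sub_apply, Pi.pow_apply]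
    field_simp
    push_cast
    ring
  have h0 : (fun t : ℝ => arrowSecular (x + t • v) ((arrowMap (x + t • v)).2 k)) =ᶠ[nhds 0]
      fun _ => 0 := by
    filter_upwards [hx.eventually_line v] with t ht using ht.arrowSpectrum.secular k
  have e := hd.unique ((hasDerivAt_const (0 : ℝ) (0 : ℝ)).congr_of_eventuallyEq h0)
  have hq := s.sq_mul k
  rw [← hldef] at hq
  have h1 : ∑ i : Fin m, (2 * (x.1 i.castSucc / (l - x.2 i)) * v.1 i.castSucc -
          (x.1 i.castSucc / (l - x.2 i)) ^ 2 * (l' - v.2 i)) =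
      ∑ i : Fin m, (2 * (x.1 i.castSucc / (l - x.2 i)) * v.1 i.castSucc +
          (x.1 i.castSucc / (l - x.2 i)) ^ 2 * v.2 i) - (arrowSecularDeriv x l - 1) * l' := by
    rw [arrowSecularDeriv, add_sub_cancel_left, Finset.sum_mul, ← Finset.sum_sub_distrib]
    refine Finset.sum_congr rfl fun i _ => ?_
    rw [div_pow]
    ring
  rw [h1] at e
  linear_combination ((arrowMap x).1 k) ^ 2 * e - l' * hq

/-- Logarithmic differentiation of `q_k² ∏_{j ≠ k} (lam_k - lam_j) = ∏ᵢ (lam_k - d_i)`: modulo the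
differentials of the eigenvalues, `dq_k` does not depend on `dc`. -/
theorem ArrowGeneric.exists_fderiv_fst (hx : ArrowGeneric x) :
    ∃ N : Matrix (Fin (m + 1)) (Fin (m + 1)) ℝ,
      ∀ (v : (Fin (m + 1) → ℝ) × (Fin m → ℝ)) (k : Fin (m + 1)),
        (fderiv ℝ arrowMap x v).1 k =
          -((arrowMap x).1 k / 2) * ∑ i : Fin m, v.2 i / ((arrowMap x).2 k - x.2 i) +
            (N *ᵥ (fderiv ℝ arrowMap x v).2) k := by
  have s := hx.arrowSpectrum
  set q := (arrowMap x).1 with hqdef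
  set lam := (arrowMap x).2 with hldef
  refine ⟨Matrix.diagonal (fun k => q k / 2 * (∑ i : Fin m, 1 / (lam k - x.2 i) -
      ∑ j ∈ Finset.univ.erase k, 1 / (lam k - lam j))) +
    Matrix.of fun k j => if j = k then 0 else q k / 2 * (1 / (lam k - lam j)), fun v k => ?_⟩
  set l' := (fderiv ℝ arrowMap x v).2
  have hsub : ∀ j ∈ Finset.univ.erase k, lam k - lam j ≠ 0 := fun j hj =>
    sub_ne_zero.2 fun e => (Finset.mem_erase.1 hj).1 (s.strictAnti.injective e).symm
  have hq : HasDerivAt (fun t : ℝ => Real.log ((arrowMap (x + t • v)).1 k))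
      ((fderiv ℝ arrowMap x v).1 k / q k) 0 := by
    simpa using (hx.hasDerivAt_line v k).1.log (by simpa using (s.pos k).ne')
  -- `Real.log` ignores signs, so the differences may be negative
  have hll : ∀ j ∈ Finset.univ.erase k, HasDerivAt (fun t : ℝ =>
      Real.log ((arrowMap (x + t • v)).2 k - (arrowMap (x + t • v)).2 j))
      ((l' k - l' j) / (lam k - lam j)) 0 := fun j hj => by
    simpa using ((hx.hasDerivAt_line v k).2.sub (hx.hasDerivAt_line v j).2).log
      (by simpa using hsub j hj)
  have hld : ∀ i ∈ Finset.univ, HasDerivAt (fun t : ℝ =>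
      Real.log ((arrowMap (x + t • v)).2 k - (x + t • v).2 i))
      ((l' k - v.2 i) / (lam k - x.2 i)) 0 := fun i _ => by
    have := ((hx.hasDerivAt_line v k).2.sub (hasDerivAt_line_snd (x := x) v i)).log
      (by simpa using s.ne k i)
    refine this.congr_deriv ?_
    simp [hldef, l']
  have hev : (fun t : ℝ => 2 * Real.log ((arrowMap (x + t • v)).1 k) +
      ∑ j ∈ Finset.univ.erase k,
        Real.log ((arrowMap (x + t • v)).2 k - (arrowMap (x + t • v)).2 j)) =ᶠ[nhds 0]
      fun t => ∑ i : Fin m, Real.log ((arrowMap (x + t • v)).2 k - (x + t • v).2 i) := by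
    filter_upwards [hx.eventually_line v] with t ht
    have st := ht.arrowSpectrum
    have hne : ∀ j ∈ Finset.univ.erase k,
        (arrowMap (x + t • v)).2 k - (arrowMap (x + t • v)).2 j ≠ 0 := fun j hj =>
      sub_ne_zero.2 fun e => (Finset.mem_erase.1 hj).1 (st.strictAnti.injective e).symm
    rw [← Real.log_prod hne, ← Real.log_prod fun i _ => st.ne k i, ← st.sq_mul_prod ht k,
      Real.log_mul (pow_ne_zero 2 (st.pos k).ne') (Finset.prod_ne_zero_iff.2 hne), Real.log_pow]
    norm_num
  have e := ((hq.const_mul 2).add (HasDerivAt.fun_sum hll)).unique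
    ((HasDerivAt.fun_sum hld).congr_of_eventuallyEq hev)
  have hN : (Matrix.of (fun k j => if j = k then 0 else q k / 2 * (1 / (lam k - lam j))) *ᵥ l') k =
      q k / 2 * ∑ j ∈ Finset.univ.erase k, l' j / (lam k - lam j) := by
    rw [Matrix.mulVec, dotProduct, ← Finset.add_sum_erase _ _ (Finset.mem_univ k), Finset.mul_sum]
    simp only [Matrix.of_apply, if_true, zero_mul, zero_add]
    refine Finset.sum_congr rfl fun j hj => ?_
    rw [if_neg (Finset.mem_erase.1 hj).1]
    ring
  rw [Matrix.add_mulVec, Pi.add_apply, hN, Matrix.mulVec_diagonal]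
  simp only [sub_div, Finset.sum_sub_distrib] at e
  have h1 : ∑ i : Fin m, l' k / (lam k - x.2 i) = l' k * ∑ i : Fin m, 1 / (lam k - x.2 i) := by
    rw [Finset.mul_sum]
    exact Finset.sum_congr rfl fun i _ => by ring
  have h2 : ∑ j ∈ Finset.univ.erase k, l' k / (lam k - lam j) =
      l' k * ∑ j ∈ Finset.univ.erase k, 1 / (lam k - lam j) := by
    rw [Finset.mul_sum]
    exact Finset.sum_congr rfl fun i _ => by ring
  rw [h1, h2] at e
  have hq0 : q k ≠ 0 := (s.pos k).ne'
  have h3 : (fderiv ℝ arrowMap x v).1 k = q k / 2 * (2 * ((fderiv ℝ arrowMap x v).1 k / q k)) := by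
    field_simp
  rw [h3]
  linear_combination q k / 2 * e

/-- Since `q` stays on the unit sphere, its derivative is tangent to the sphere. -/
theorem ArrowGeneric.sum_mul_fderiv_fst (hx : ArrowGeneric x)
    (v : (Fin (m + 1) → ℝ) × (Fin m → ℝ)) :
    ∑ k, (fderiv ℝ arrowMap x v).1 k * (arrowMap x).1 k = 0 := by
  have hd : HasDerivAt (fun t : ℝ => ∑ k, (arrowMap (x + t • v)).1 k ^ 2)
      (∑ k, 2 * ((fderiv ℝ arrowMap x v).1 k * (arrowMap x).1 k)) 0 := by
    refine HasDerivAt.fun_sum fun k _ => ((hx.hasDerivAt_line v k).1.pow 2).congr_deriv ?_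
    simp
    ring
  have hev : (fun t : ℝ => ∑ k, (arrowMap (x + t • v)).1 k ^ 2) =ᶠ[nhds 0] fun _ => 1 := by
    filter_upwards [hx.eventually_line v] with t ht using ht.arrowSpectrum.sum_sq
  have e := hd.unique ((hasDerivAt_const (0 : ℝ) (1 : ℝ)).congr_of_eventuallyEq hev)
  rw [← Finset.mul_sum] at e
  simpa using e

end

/-! ### The determinant of the cone over the spectral data -/

/-- If the first component of `Φ` depends only on the first variable, up to a linear function of the
second component, then the matrix of `Φ` is block lower triangular up to row operations. -/
theorem LinearMap.toMatrix_of_triangular {n : Type*} [Fintype n] [DecidableEq n]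
    (Φ : (n → ℝ) × (n → ℝ) →ₗ[ℝ] (n → ℝ) × (n → ℝ)) (K N S T : Matrix n n ℝ)
    (h1 : ∀ u, (Φ u).1 = K *ᵥ u.1 + N *ᵥ (Φ u).2) (h2 : ∀ u, (Φ u).2 = S *ᵥ u.1 + T *ᵥ u.2) :
    LinearMap.toMatrix ((Pi.basisFun ℝ n).prod (Pi.basisFun ℝ n))
      ((Pi.basisFun ℝ n).prod (Pi.basisFun ℝ n)) Φ =
      Matrix.fromBlocks 1 N 0 1 * Matrix.fromBlocks K 0 S T := by
  rw [Matrix.fromBlocks_multiply]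
  ext (a | a) (b | b) <;>
    simp [LinearMap.toMatrix_apply, h1, h2] <;> rfl

theorem LinearMap.det_of_triangular {n : Type*} [Fintype n] [DecidableEq n]
    (Φ : (n → ℝ) × (n → ℝ) →ₗ[ℝ] (n → ℝ) × (n → ℝ)) (K N S T : Matrix n n ℝ)
    (h1 : ∀ u, (Φ u).1 = K *ᵥ u.1 + N *ᵥ (Φ u).2) (h2 : ∀ u, (Φ u).2 = S *ᵥ u.1 + T *ᵥ u.2) :
    LinearMap.det Φ = K.det * T.det := by
  rw [← LinearMap.det_toMatrix ((Pi.basisFun ℝ n).prod (Pi.basisFun ℝ n)),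
    LinearMap.toMatrix_of_triangular Φ K N S T h1 h2, Matrix.det_mul,
    Matrix.det_fromBlocks_zero₂₁, Matrix.det_fromBlocks_zero₁₂]
  simp

theorem abs_det_of_mem_orthogonalGroup {n : Type*} [Fintype n] [DecidableEq n] {Q : Matrix n n ℝ}
    (hQ : Q ∈ Matrix.orthogonalGroup n ℝ) : |Q.det| = 1 := by
  have h : Qᵀ * Q = 1 := (Matrix.mem_orthogonalGroup_iff' _ _).1 hQ
  have := congrArg Matrix.det h
  rw [Matrix.det_mul, Matrix.det_transpose, Matrix.det_one, ← abs_mul_abs_self] at this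
  nlinarith [abs_nonneg Q.det]

section

variable {m : ℕ}

/-- The coordinates `(c, d)` inside `((d, r), c)`, where `r` is the radial coordinate. -/
def coneCoords (m : ℕ) : (Fin (m + 1) → ℝ) × (Fin (m + 1) → ℝ) →L[ℝ]
    (Fin (m + 1) → ℝ) × (Fin m → ℝ) :=
  (ContinuousLinearMap.snd ℝ _ _).prod
    ((ContinuousLinearMap.pi fun i : Fin m =>
      ContinuousLinearMap.proj (R := ℝ) (φ := fun _ : Fin (m + 1) => ℝ) i.castSucc) ∘L
        ContinuousLinearMap.fst ℝ _ _)

@[simp] theorem coneCoords_apply (z : (Fin (m + 1) → ℝ) × (Fin (m + 1) → ℝ)) :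
    coneCoords m z = (z.2, fun i => z.1 i.castSucc) := rfl

/-- The cone `((d, r), c) ↦ (r q, lam)` over the map `(c, d) ↦ (q, lam)`. It is a map between
spaces of equal dimension; the radial coordinate is stored as the last entry next to `d`. -/
noncomputable def arrowCone (z : (Fin (m + 1) → ℝ) × (Fin (m + 1) → ℝ)) :
    (Fin (m + 1) → ℝ) × (Fin (m + 1) → ℝ) :=
  (fun k => z.1 (Fin.last m) * (arrowMap (coneCoords m z)).1 k, (arrowMap (coneCoords m z)).2)

variable {z : (Fin (m + 1) → ℝ) × (Fin (m + 1) → ℝ)}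

theorem differentiableAt_arrowCone (hz : ArrowGeneric (coneCoords m z)) :
    DifferentiableAt ℝ arrowCone z := by
  have h : DifferentiableAt ℝ (fun z => arrowMap (coneCoords m z)) z :=
    DifferentiableAt.comp z hz.differentiableAt (coneCoords m).differentiableAt
  refine DifferentiableAt.prodMk (differentiableAt_pi.2 fun k => ?_) h.snd
  exact DifferentiableAt.mul (by fun_prop)
    ((EuclideanSpace.proj k : EuclideanSpace ℝ (Fin (m + 1)) →L[ℝ] ℝ).differentiableAt.comp z h.fst)

theorem fderiv_arrowCone (hz : ArrowGeneric (coneCoords m z))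
    (u : (Fin (m + 1) → ℝ) × (Fin (m + 1) → ℝ)) :
    fderiv ℝ arrowCone z u =
      (fun k => u.1 (Fin.last m) * (arrowMap (coneCoords m z)).1 k +
        z.1 (Fin.last m) * (fderiv ℝ arrowMap (coneCoords m z) (coneCoords m u)).1 k,
      (fderiv ℝ arrowMap (coneCoords m z) (coneCoords m u)).2) := by
  have hline : HasDerivAt (fun t : ℝ => z + t • u) u 0 := by
    simpa using ((hasDerivAt_id' (0 : ℝ)).smul_const u).const_add z
  have h : HasDerivAt (fun t : ℝ => arrowCone (z + t • u)) (fderiv ℝ arrowCone z u) 0 := by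
    have hf : HasFDerivAt arrowCone (fderiv ℝ arrowCone z) (z + (0 : ℝ) • u) := by
      simpa using (differentiableAt_arrowCone hz).hasFDerivAt
    exact hf.comp_hasDerivAt (0 : ℝ) hline
  refine h.unique (HasDerivAt.prodMk (hasDerivAt_pi.2 fun k => ?_) (hasDerivAt_pi.2 fun k => ?_))
  · have h1 : HasDerivAt (fun t : ℝ => (z + t • u).1 (Fin.last m)) (u.1 (Fin.last m)) 0 := by
      simpa using ((hasDerivAt_id' (0 : ℝ)).mul_const (u.1 (Fin.last m))).const_add
        (z.1 (Fin.last m))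
    have h2 := h1.mul (hz.hasDerivAt_line (coneCoords m u) k).1
    simp only [← map_smul, ← map_add] at h2
    refine h2.congr_deriv ?_
    simp
  · have h2 := (hz.hasDerivAt_line (coneCoords m u) k).2
    simp only [← map_smul, ← map_add] at h2
    exact h2

/-- Modulo row operations both diagonal blocks of the derivative of the cone are, by the
Cauchy-like form of the eigenvector matrix, `Qᵀ` with rescaled rows and columns. -/
theorem abs_det_fderiv_arrowCone (hz : ArrowGeneric (coneCoords m z)) :
    |(fderiv ℝ arrowCone z).det| = |z.1 (Fin.last m)| ^ m *
      ((∏ k, (arrowMap (coneCoords m z)).1 k) / ∏ i : Fin m, |z.2 i.castSucc|) := by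
  obtain ⟨N, hN⟩ := hz.exists_fderiv_fst
  have hf := fderiv_arrowCone hz
  have hlam := hz.fderiv_snd
  have s := hz.arrowSpectrum
  set x := coneCoords m z with hx
  set q := (arrowMap x).1 with hq
  set lam := (arrowMap x).2 with hlamdef
  set r := z.1 (Fin.last m) with hr
  set Q := arrowEigenvectors x q lam with hQ
  have hxz : ∀ i : Fin m, x.1 i.castSucc = z.2 i.castSucc := fun _ => rfl
  set a : Fin (m + 1) → ℝ :=
    Fin.snoc (α := fun _ => ℝ) (fun i : Fin m => -(r / (2 * x.1 i.castSucc))) 1 with ha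
  set b : Fin (m + 1) → ℝ := Fin.snoc (α := fun _ => ℝ) (fun _ : Fin m => 2) 1 with hb
  set S : Matrix (Fin (m + 1)) (Fin (m + 1)) ℝ := Matrix.of fun k j =>
    (Fin.snoc (α := fun _ => ℝ) (fun i : Fin m => Q i.castSucc k ^ 2) 0 : Fin (m + 1) → ℝ) j
    with hS
  have hmv : ∀ (M : Matrix (Fin (m + 1)) (Fin (m + 1)) ℝ) (w : Fin (m + 1) → ℝ) (k : Fin (m + 1)),
      (M *ᵥ w) k = ∑ i : Fin m, M k i.castSucc * w i.castSucc + M k (Fin.last m) * w (Fin.last m) :=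
    fun M w k => Fin.sum_univ_castSucc _
  have hdet : (fderiv ℝ arrowCone z).det =
      (Qᵀ * Matrix.diagonal a).det * (Matrix.diagonal q * Qᵀ * Matrix.diagonal b).det := by
    refine LinearMap.det_of_triangular _ _ (r • N) S _ (fun u => ?_) (fun u => ?_)
    · funext k
      rw [ContinuousLinearMap.coe_coe, hf]
      simp only [hN, Pi.add_apply, Matrix.smul_mulVec, Pi.smul_apply, smul_eq_mul]
      rw [hmv (Qᵀ * Matrix.diagonal a)]
      simp only [Matrix.mul_diagonal, Matrix.transpose_apply, ha, hQ, Fin.snoc_castSucc,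
        Fin.snoc_last, arrowEigenvectors_castSucc, arrowEigenvectors_last, coneCoords_apply]
      have : ∑ i : Fin m, x.1 i.castSucc * q k / (lam k - x.2 i) *
          -(r / (2 * x.1 i.castSucc)) * u.1 i.castSucc =
          -(r * (q k / 2)) * ∑ i : Fin m, u.1 i.castSucc / (lam k - x.2 i) := by
        rw [Finset.mul_sum]
        refine Finset.sum_congr rfl fun i _ => ?_
        have := hz.1 i
        have := s.ne k i
        field_simp
      rw [this]
      ring
    · funext k
      rw [ContinuousLinearMap.coe_coe, hf]
      simp only [hlam, Pi.add_apply]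
      rw [hmv, hmv]
      simp only [Matrix.mul_diagonal, Matrix.diagonal_mul, Matrix.transpose_apply, hb, hS, hQ,
        Matrix.of_apply, Fin.snoc_castSucc,
        Fin.snoc_last, arrowEigenvectors_castSucc, arrowEigenvectors_last, coneCoords_apply]
      rw [mul_add, Finset.mul_sum]
      simp only [mul_add]
      rw [Finset.sum_add_distrib]
      have e1 : ∑ i : Fin m, q k ^ 2 * (2 * (x.1 i.castSucc / (lam k - x.2 i)) * u.2 i.castSucc) =
          ∑ i : Fin m, q k * (x.1 i.castSucc * q k / (lam k - x.2 i)) * 2 * u.2 i.castSucc :=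
        Finset.sum_congr rfl fun i _ => by ring
      have e2 : ∑ i : Fin m, q k ^ 2 * ((x.1 i.castSucc / (lam k - x.2 i)) ^ 2 * u.1 i.castSucc) =
          ∑ i : Fin m, (x.1 i.castSucc * q k / (lam k - x.2 i)) ^ 2 * u.1 i.castSucc :=
        Finset.sum_congr rfl fun i _ => by ring
      rw [e1, e2]
      ring
  have hQdet := abs_det_of_mem_orthogonalGroup s.orthogonal
  have hprod : ∏ k, |q k| = ∏ k, q k := Finset.prod_congr rfl fun k _ => abs_of_pos (s.pos k)
  rw [hdet]
  simp only [Matrix.det_mul, Matrix.det_diagonal, Matrix.det_transpose, abs_mul, Finset.abs_prod]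
  rw [hprod, hQdet, Fin.prod_univ_castSucc, Fin.prod_univ_castSucc (f := fun i => |b i|)]
  simp only [ha, hb, Fin.snoc_castSucc, Fin.snoc_last, abs_neg, abs_div, abs_mul, hxz,
    Finset.prod_div_distrib, Finset.prod_mul_distrib, Finset.prod_const, Finset.card_univ,
    Fintype.card_fin, abs_one, abs_two]
  have h0 : ∏ i : Fin m, |z.2 i.castSucc| ≠ 0 :=
    Finset.prod_ne_zero_iff.2 fun i _ => abs_ne_zero.2 (hz.1 i)
  field_simp

end

/-! ### The Jacobian -/

section

variable {m : ℕ} {x : (Fin (m + 1) → ℝ) × (Fin m → ℝ)}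

theorem det_transpose_mul_self_submatrix {n k : Type*} [Fintype n] [DecidableEq n] [Fintype k]
    [DecidableEq k] (B : Matrix n n ℝ) (e : k ≃ n) :
    ((B.submatrix id e)ᵀ * B.submatrix id e).det = B.det ^ 2 := by
  have : (B.submatrix id e)ᵀ * B.submatrix id e = (Bᵀ * B).submatrix e e := by
    ext i j
    simp [Matrix.mul_apply]
  rw [this, Matrix.det_submatrix_equiv_self, Matrix.det_mul, Matrix.det_transpose, sq]

/-- Columns for `(c, d)` followed by one for the radial coordinate, in the order in which
`arrowCone` lists its variables. -/
def coneColumns (m : ℕ) : (Fin (m + 1) ⊕ Fin m) ⊕ Unit ≃ Fin (m + 1) ⊕ Fin (m + 1) :=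
  ((Equiv.sumAssoc _ _ _).trans (Equiv.sumCongr (Equiv.refl _)
    ((Equiv.optionEquivSumPUnit (Fin m)).symm.trans finSuccEquivLast.symm))).trans
      (Equiv.sumComm _ _)

/-- At radius `1` the radial column of the derivative of the cone is a unit vector orthogonal to the
columns of partial derivatives, hence does not change the Gram determinant. -/
theorem surfaceJacobian_eq_abs_det (hx : ArrowGeneric x) :
    surfaceJacobian arrowMap x = |(fderiv ℝ (arrowCone (m := m))
      ((Fin.snoc (α := fun _ => ℝ) x.2 1 : Fin (m + 1) → ℝ), x.1)).det| := by
  set z : (Fin (m + 1) → ℝ) × (Fin (m + 1) → ℝ) := (Fin.snoc (α := fun _ => ℝ) x.2 1, x.1) with hzdef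
  have hzx : coneCoords m z = x := Prod.ext rfl (by funext i; simp [hzdef])
  have hz : ArrowGeneric (coneCoords m z) := hzx.symm ▸ hx
  have hf := fderiv_arrowCone hz
  rw [hzx] at hf
  have hr : z.1 (Fin.last m) = 1 := by simp [hzdef]
  have s := hx.arrowSpectrum
  set J := partialsMatrix arrowMap x with hJ
  set C : Matrix (Fin (m + 1) ⊕ Fin (m + 1)) Unit ℝ :=
    Matrix.of fun a _ => Sum.elim (fun k => (arrowMap x).1 k) (fun _ => 0) a with hC
  set β := (Pi.basisFun ℝ (Fin (m + 1))).prod (Pi.basisFun ℝ (Fin (m + 1)))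
  set B := LinearMap.toMatrix β β
    (fderiv ℝ (arrowCone (m := m)) z : _ →ₗ[ℝ] (Fin (m + 1) → ℝ) × (Fin (m + 1) → ℝ)) with hB
  have hBdet : B.det = (fderiv ℝ (arrowCone (m := m)) z).det := LinearMap.det_toMatrix β _
  have hzero : (fun _ : Fin m => (0 : ℝ)) = 0 := rfl
  have hder0 : fderiv ℝ arrowMap x ((0 : Fin (m + 1) → ℝ), (0 : Fin m → ℝ)) = 0 := map_zero _
  have hsingle : ∀ b : Fin m, (fun i : Fin m =>
      (Pi.single b.castSucc 1 : Fin (m + 1) → ℝ) i.castSucc) = Pi.single b 1 := by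
    intro b
    funext i
    simp [Pi.single_apply]
  have hsub : B.submatrix id (coneColumns m) = Matrix.fromCols J C := by
    ext a b
    rcases a with a | a <;> rcases b with (b | b) | b <;>
      simp [hB, hJ, hC, hf, hr, partialsMatrix, LinearMap.toMatrix_apply, coneColumns, β,
        hzero, hsingle, hder0]
  have hJC : Jᵀ * C = 0 := by
    ext b u
    simp only [Matrix.mul_apply, Fintype.sum_sum_type, Matrix.transpose_apply, hC, Matrix.of_apply,
      Sum.elim_inl, Sum.elim_inr, mul_zero, Finset.sum_const_zero, add_zero, Matrix.zero_apply]
    rw [← hx.sum_mul_fderiv_fst (((Pi.basisFun ℝ (Fin (m + 1))).prod (Pi.basisFun ℝ (Fin m))) b)]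
    refine Finset.sum_congr rfl fun k _ => ?_
    congr 1
    simp [hJ, partialsMatrix, LinearMap.toMatrix_apply]
  have hCC : Cᵀ * C = 1 := by
    ext
    simp [Matrix.mul_apply, hC, ← sq, s.sum_sq]
  have hblock : (Matrix.fromCols J C)ᵀ * Matrix.fromCols J C =
      Matrix.fromBlocks (Jᵀ * J) 0 0 1 := by
    rw [Matrix.transpose_fromCols, Matrix.fromRows_mul_fromCols, hJC, hCC]
    have : Cᵀ * J = 0 := by
      rw [← Matrix.transpose_transpose J, ← Matrix.transpose_mul, hJC, Matrix.transpose_zero]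
    rw [this]
  have := det_transpose_mul_self_submatrix B (coneColumns m)
  rw [hsub, hblock, Matrix.det_fromBlocks_zero₂₁, Matrix.det_one, mul_one, hBdet] at this
  rw [surfaceJacobian, ← hJ, this, Real.sqrt_sq_eq_abs]

theorem surfaceJacobian_arrowMap (hx : ArrowGeneric x) :
    surfaceJacobian arrowMap x =
      (∏ k, (arrowMap x).1 k) / ∏ i : Fin m, |x.1 i.castSucc| := by
  have hzx : coneCoords m ((Fin.snoc (α := fun _ => ℝ) x.2 1 : Fin (m + 1) → ℝ), x.1) = x :=
    Prod.ext rfl (by funext i; simp)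
  rw [surfaceJacobian_eq_abs_det hx, abs_det_fderiv_arrowCone (hzx.symm ▸ hx), hzx]
  simp

end

/-! ### Change of variables -/

section

variable {m : ℕ}

/-- For measurable sets over the unit sphere, `dq dλ`-measure is Lebesgue measure of the cone. -/
theorem sphereArea_prod_apply {S : Set (EuclideanSpace ℝ (Fin (m + 1)) × (Fin (m + 1) → ℝ))}
    (hS : MeasurableSet S) (hsphere : ∀ p ∈ S, ‖p.1‖ = 1)
    (hcone : MeasurableSet {p : EuclideanSpace ℝ (Fin (m + 1)) × (Fin (m + 1) → ℝ) |
      ∃ r ∈ Set.Ioo (0 : ℝ) 1, ∃ s ∈ S, p = (r • s.1, s.2)}) :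
    ((sphereArea (m + 1)).prod (volume : Measure (Fin (m + 1) → ℝ))) S =
      (m + 1 : ℕ) * volume {p : EuclideanSpace ℝ (Fin (m + 1)) × (Fin (m + 1) → ℝ) |
        ∃ r ∈ Set.Ioo (0 : ℝ) 1, ∃ s ∈ S, p = (r • s.1, s.2)} := by
  have : IsFiniteMeasure (sphereArea (m + 1)) := by
    unfold sphereArea
    infer_instance
  rw [Measure.prod_apply_symm hS, Measure.volume_eq_prod, Measure.prod_apply_symm hcone,
    ← lintegral_const_mul _ (measurable_measure_prodMk_right hcone)]
  refine lintegral_congr fun l => ?_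
  have hSl : MeasurableSet ((fun y => (y, l)) ⁻¹' S) := measurable_prodMk_right hS
  rw [sphereArea, Measure.map_apply measurable_subtype_coe hSl,
    Measure.toSphere_apply' _ (measurable_subtype_coe hSl), finrank_euclideanSpace_fin]
  congr 2
  ext y
  simp only [Set.mem_smul, Set.mem_image, Set.mem_preimage, Set.mem_ofPred_eq, Prod.mk.injEq]
  constructor
  · rintro ⟨r, hr, _, ⟨w, hw, rfl⟩, rfl⟩
    exact ⟨r, hr, _, hw, rfl, rfl⟩
  · rintro ⟨r, hr, s, hs, rfl, rfl⟩
    exact ⟨r, hr, s.1, ⟨⟨s.1, by simpa using hsphere s hs⟩, hs, rfl⟩, rfl⟩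

/-- The measure-preserving reordering `((d, r), c) ↦ (r, (c, d))`. -/
theorem measurePreserving_coneCoords (m : ℕ) :
    MeasurePreserving
      (fun z : (Fin (m + 1) → ℝ) × (Fin (m + 1) → ℝ) => (z.1 (Fin.last m), coneCoords m z)) := by
  have h1 := (volume_preserving_piFinSuccAbove (fun _ : Fin (m + 1) => ℝ) (Fin.last m)).prod
    (MeasurePreserving.id (volume : Measure (Fin (m + 1) → ℝ)))
  have h2 := measurePreserving_prodAssoc (volume : Measure ℝ) (volume : Measure (Fin m → ℝ))
    (volume : Measure (Fin (m + 1) → ℝ))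
  have h3 := (MeasurePreserving.id (volume : Measure ℝ)).prod
    (Measure.measurePreserving_swap (μ := (volume : Measure (Fin m → ℝ)))
      (ν := (volume : Measure (Fin (m + 1) → ℝ))))
  have h := h3.comp (h2.comp h1)
  have hfun : (fun z : (Fin (m + 1) → ℝ) × (Fin (m + 1) → ℝ) =>
      (z.1 (Fin.last m), coneCoords m z)) = Prod.map id Prod.swap ∘ MeasurableEquiv.prodAssoc ∘
        Prod.map (MeasurableEquiv.piFinSuccAbove (fun _ : Fin (m + 1) => ℝ) (Fin.last m)) id := by
    funext z
    simp [MeasurableEquiv.piFinSuccAbove, Fin.insertNthEquiv, MeasurableEquiv.prodAssoc]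
    rfl
  rw [hfun]
  exact h

theorem continuousOn_arrowMap (m : ℕ) : ContinuousOn (arrowMap (m := m)) (positiveArrows m) :=
  fun _ hx => (arrowGeneric_of_mem_positiveArrows hx).differentiableAt.continuousAt.continuousWithinAt

theorem injOn_arrowMap (m : ℕ) : Set.InjOn (arrowMap (m := m)) (positiveArrows m) := by
  intro x hx y hy hxy
  have sx := (arrowGeneric_of_mem_positiveArrows hx).arrowSpectrum
  have sy := (arrowGeneric_of_mem_positiveArrows hy).arrowSpectrum
  rw [← hxy] at sy
  exact sx.eq_of_mem_positiveArrows sy hx hy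

theorem ArrowGeneric.norm_arrowMap_fst {x : (Fin (m + 1) → ℝ) × (Fin m → ℝ)}
    (hx : ArrowGeneric x) : ‖(arrowMap x).1‖ = 1 := by
  rw [EuclideanSpace.norm_eq, Real.sqrt_eq_one]
  simpa using hx.arrowSpectrum.sum_sq

theorem injOn_arrowCone (m : ℕ) : Set.InjOn (arrowCone (m := m))
    {z | 0 < z.1 (Fin.last m) ∧ coneCoords m z ∈ positiveArrows m} := by
  rintro z ⟨hz0, hz⟩ w ⟨hw0, hw⟩ hzw
  have sz := (arrowGeneric_of_mem_positiveArrows hz).arrowSpectrum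
  have sw := (arrowGeneric_of_mem_positiveArrows hw).arrowSpectrum
  have h2 : (arrowMap (coneCoords m z)).2 = (arrowMap (coneCoords m w)).2 :=
    show (arrowCone z).2 = (arrowCone w).2 from congrArg Prod.snd hzw
  have h1 : ∀ k, z.1 (Fin.last m) * (arrowMap (coneCoords m z)).1 k =
      w.1 (Fin.last m) * (arrowMap (coneCoords m w)).1 k := fun k =>
    show (arrowCone z).1 k = (arrowCone w).1 k from congrFun (congrArg Prod.fst hzw) k
  have hr : z.1 (Fin.last m) = w.1 (Fin.last m) := by
    have e : ∑ k, (z.1 (Fin.last m) * (arrowMap (coneCoords m z)).1 k) ^ 2 =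
        ∑ k, (w.1 (Fin.last m) * (arrowMap (coneCoords m w)).1 k) ^ 2 :=
      Finset.sum_congr rfl fun k _ => by rw [h1]
    simp only [mul_pow, ← Finset.mul_sum, sz.sum_sq, sw.sum_sq, mul_one] at e
    exact (sq_eq_sq₀ hz0.le hw0.le).1 e
  have h3 : coneCoords m z = coneCoords m w := by
    refine injOn_arrowMap m hz hw (Prod.ext ?_ h2)
    ext k
    have := h1 k
    rw [hr] at this
    exact mul_left_cancel₀ hw0.ne' this
  refine Prod.ext (funext fun i => ?_) (congrArg Prod.fst h3)
  induction i using Fin.lastCases with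
  | last => exact hr
  | cast i => exact congrFun (congrArg Prod.snd h3) i

theorem lintegral_ofReal_pow_Ioo (m : ℕ) :
    ∫⁻ r in Set.Ioo (0 : ℝ) 1, ENNReal.ofReal (|r| ^ m) = ((m + 1 : ℕ) : ENNReal)⁻¹ := by
  have h1 : ∫⁻ r in Set.Ioo (0 : ℝ) 1, ENNReal.ofReal (|r| ^ m) =
      ∫⁻ r in Set.Ioc (0 : ℝ) 1, ENNReal.ofReal (r ^ m) := by
    rw [Measure.restrict_congr_set Ioo_ae_eq_Ioc]
    exact setLIntegral_congr_fun measurableSet_Ioc fun r hr => by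
      simp only [abs_of_pos hr.1]
  rw [h1, ← ofReal_integral_eq_lintegral_ofReal, ← intervalIntegral.integral_of_le zero_le_one,
    integral_pow]
  · rw [one_pow, zero_pow (Nat.succ_ne_zero m), sub_zero, one_div,
      ENNReal.ofReal_inv_of_pos (by positivity)]
    norm_cast
  · exact (((continuous_pow m).intervalIntegrable (0 : ℝ) 1)).1
  · filter_upwards [ae_restrict_mem measurableSet_Ioc] with r hr using pow_nonneg hr.1.le m

theorem sphereArea_prod_image_arrowMap {E : Set ((Fin (m + 1) → ℝ) × (Fin m → ℝ))}
    (hE : MeasurableSet E) (hpos : E ⊆ positiveArrows m) :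
    ((sphereArea (m + 1)).prod (volume : Measure (Fin (m + 1) → ℝ))) (arrowMap '' E) =
      ∫⁻ x in E, ENNReal.ofReal ((∏ i, (arrowMap x).1 i) / ∏ i : Fin m, x.1 i.castSucc) := by
  have hgen : ∀ x ∈ E, ArrowGeneric x := fun x hx => arrowGeneric_of_mem_positiveArrows (hpos hx)
  set D : Set ((Fin (m + 1) → ℝ) × (Fin (m + 1) → ℝ)) :=
    (fun z => (z.1 (Fin.last m), coneCoords m z)) ⁻¹' (Set.Ioo (0 : ℝ) 1 ×ˢ E) with hD
  have hDmeas : MeasurableSet D :=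
    (measurePreserving_coneCoords m).measurable (measurableSet_Ioo.prod hE)
  have hDgen : ∀ z ∈ D, ArrowGeneric (coneCoords m z) := fun z hz => hgen _ hz.2
  have hderiv : ∀ z ∈ D, HasFDerivWithinAt arrowCone (fderiv ℝ (arrowCone (m := m)) z) D z :=
    fun z hz => (differentiableAt_arrowCone (hDgen z hz)).hasFDerivAt.hasFDerivWithinAt
  have hinj : Set.InjOn (arrowCone (m := m)) D :=
    (injOn_arrowCone m).mono fun z (hz : z ∈ D) => And.intro hz.1.1 (hpos hz.2)
  have himage : MeasurableSet (arrowCone '' D) := measurable_image_of_fderivWithin hDmeas hderiv hinj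
  have hcone : {p : EuclideanSpace ℝ (Fin (m + 1)) × (Fin (m + 1) → ℝ) |
      ∃ r ∈ Set.Ioo (0 : ℝ) 1, ∃ s ∈ arrowMap '' E, p = (r • s.1, s.2)} =
      Prod.map (WithLp.ofLp) id ⁻¹' (arrowCone '' D) := by
    ext p
    simp only [Set.mem_ofPred_eq, Set.mem_preimage, Set.mem_image, exists_exists_and_eq_and]
    constructor
    · rintro ⟨r, hr, x, hx, rfl⟩
      have hz : coneCoords m ((Fin.snoc (α := fun _ => ℝ) x.2 r : Fin (m + 1) → ℝ), x.1) = x :=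
        Prod.ext rfl (by funext i; simp)
      refine ⟨(Fin.snoc (α := fun _ => ℝ) x.2 r, x.1), ⟨by simpa using hr, ?_⟩, ?_⟩
      · change coneCoords m (Fin.snoc (α := fun _ => ℝ) x.2 r, x.1) ∈ E
        rwa [hz]
      rw [arrowCone, hz]
      refine Prod.ext (funext fun k => ?_) rfl
      simp
    · rintro ⟨z, hz, hzp⟩
      refine ⟨z.1 (Fin.last m), hz.1, coneCoords m z, hz.2, ?_⟩
      refine Prod.ext ?_ (congrArg Prod.snd hzp).symm
      ext k
      exact (congrFun (congrArg Prod.fst hzp) k).symm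
  have hpres : MeasurePreserving (Prod.map (WithLp.ofLp) id :
      EuclideanSpace ℝ (Fin (m + 1)) × (Fin (m + 1) → ℝ) → _ × (Fin (m + 1) → ℝ)) :=
    (PiLp.volume_preserving_ofLp (Fin (m + 1))).prod (MeasurePreserving.id volume)
  have hgm : AEMeasurable (fun x : (Fin (m + 1) → ℝ) × (Fin m → ℝ) =>
      ENNReal.ofReal ((∏ k, (arrowMap x).1 k) / ∏ i : Fin m, |x.1 i.castSucc|))
      (volume.restrict E) := by
    refine ENNReal.measurable_ofReal.comp_aemeasurable (ContinuousOn.aemeasurable ?_ hE)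
    have hcont := (continuousOn_arrowMap m).mono hpos
    refine ContinuousOn.div (continuousOn_finsetProd _ fun k _ => ?_) (by fun_prop) fun x hx =>
      Finset.prod_ne_zero_iff.2 fun i _ => abs_ne_zero.2 ((hgen x hx).1 i)
    exact (EuclideanSpace.proj k : EuclideanSpace ℝ (Fin (m + 1)) →L[ℝ] ℝ).continuous.comp_continuousOn
      hcont.fst
  have : (volume : Measure ((Fin (m + 1) → ℝ) × (Fin (m + 1) → ℝ))).IsAddHaarMeasure :=
    Measure.prod.instIsAddHaarMeasure _ _
  rw [sphereArea_prod_apply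
    (hE.image_of_continuousOn_injOn ((continuousOn_arrowMap m).mono hpos)
      ((injOn_arrowMap m).mono hpos))
    (by rintro _ ⟨x, hx, rfl⟩; exact (hgen x hx).norm_arrowMap_fst)
    (hcone ▸ hpres.measurable himage), hcone, hpres.measure_preimage himage.nullMeasurableSet,
    ← lintegral_abs_det_fderiv_eq_addHaar_image volume hDmeas hderiv hinj]
  set G : ℝ × ((Fin (m + 1) → ℝ) × (Fin m → ℝ)) → ENNReal := fun w =>
    ENNReal.ofReal (|w.1| ^ m) * ENNReal.ofReal
      ((∏ k, (arrowMap w.2).1 k) / ∏ i : Fin m, |w.2.1 i.castSucc|) with hG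
  have hint : ∫⁻ z in D, ENNReal.ofReal |(fderiv ℝ (arrowCone (m := m)) z).det| =
      ∫⁻ z in D, G (z.1 (Fin.last m), coneCoords m z) := by
    refine setLIntegral_congr_fun hDmeas fun z hz => ?_
    rw [abs_det_fderiv_arrowCone (hDgen z hz), ENNReal.ofReal_mul (by positivity)]
    rfl
  have hmp : MeasurePreserving
      (fun z : (Fin (m + 1) → ℝ) × (Fin (m + 1) → ℝ) => (z.1 (Fin.last m), coneCoords m z))
      (volume.restrict D)
      ((volume.restrict (Set.Ioo (0 : ℝ) 1)).prod (volume.restrict E)) := by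
    rw [Measure.prod_restrict]
    exact (measurePreserving_coneCoords m).restrict_preimage (measurableSet_Ioo.prod hE)
  have hGm : AEMeasurable G ((volume.restrict (Set.Ioo (0 : ℝ) 1)).prod (volume.restrict E)) :=
    AEMeasurable.mul (by fun_prop)
      (hgm.comp_quasiMeasurePreserving Measure.quasiMeasurePreserving_snd)
  rw [hint, ← lintegral_map' (f := G) (by rwa [hmp.map_eq]) hmp.measurable.aemeasurable, hmp.map_eq,
    hG, lintegral_prod_mul (f := fun r : ℝ => ENNReal.ofReal (|r| ^ m)) (by fun_prop) hgm,
    lintegral_ofReal_pow_Ioo, ← mul_assoc,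
    ENNReal.mul_inv_cancel (by simp) (by simp), one_mul]
  refine setLIntegral_congr_fun hE fun x hx => ?_
  simp only [fun i : Fin m => abs_of_pos ((hpos hx).1 i)]

end

theorem lemma1 (m : ℕ) :
    -- the map is well defined wherever `d` has distinct entries and `c_1, …, c_m` do not vanish
    (∀ (c : Fin (m + 1) → ℝ) (d : Fin m → ℝ),
      (∀ i : Fin m, c i.castSucc ≠ 0) → Function.Injective d →
        ∃! p : EuclideanSpace ℝ (Fin (m + 1)) × (Fin (m + 1) → ℝ),
          IsArrowSpectralData c d p) ∧
    -- its Jacobian, pointwise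
    (∀ (c : Fin (m + 1) → ℝ) (d : Fin m → ℝ),
      (∀ i : Fin m, c i.castSucc ≠ 0) → Function.Injective d →
        DifferentiableAt ℝ arrowMap (c, d) ∧
        surfaceJacobian arrowMap (c, d) =
          (∏ i, (arrowMap (c, d)).1 i) / ∏ i : Fin m, |c i.castSucc|) ∧
    -- the identity of measures `dq dλ = (∏ q_i / ∏ c_i) dc dd` for positive `c_i`, ordered `d_i`
    (∀ E : Set ((Fin (m + 1) → ℝ) × (Fin m → ℝ)), MeasurableSet E →
      (∀ x ∈ E, (∀ i : Fin m, 0 < x.1 i.castSucc) ∧ StrictAnti x.2) →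
        ((sphereArea (m + 1)).prod (volume : Measure (Fin (m + 1) → ℝ))) (arrowMap '' E) =
          ∫⁻ x in E, ENNReal.ofReal
            ((∏ i, (arrowMap x).1 i) / ∏ i : Fin m, x.1 i.castSucc)) := by
  refine ⟨fun c d hc hd => ?_, fun c d hc hd => ?_, fun E hE hpos =>
    sphereArea_prod_image_arrowMap hE hpos⟩
  · have hx : ArrowGeneric (c, d) := ⟨hc, hd⟩
    exact ⟨arrowMap (c, d), isArrowSpectralData_arrowMap (c, d), fun p hp =>
      IsArrowSpectralData.unique hx hp (isArrowSpectralData_arrowMap (c, d))⟩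
  · have hx : ArrowGeneric (c, d) := ⟨hc, hd⟩
    exact ⟨hx.differentiableAt, surfaceJacobian_arrowMap hx⟩
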